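/- Let $V$ be a nonempty compact Hausdorff space and let $G=(V,E)$ be a compact topological packing graph, i.e. a simple graph on $V$ in which every finite clique is contained in an open clique. Let $\alpha(G)$ be its stability number, the maximum cardinality of a set of pairwise nonadjacent vertices. Let $\mathcal K(V)$ be the space of symmetric continuous functions $V\times V\to\mathbb R$ (kernels) with the supremum norm. A kernel is positive semidefinite (resp. copositive) if for every finite $U\subseteq V$ its restriction to $U\times U$ is a positive semidefinite (resp. copositive) matrix; $\mathrm{COP}(V)$ denotes the cone of copositive kernels and $\operatorname{int}\mathrm{COP}(V)$ its interior in $\mathcal K(V)$. A tensor of order $d$ is a function $T:V^d\to\mathbb R$; its symmetrization is $\sigma(T)(v)=\frac1{d!}\sum_{\pi\in \mathrm{Sym}(d)}T(v_{\pi(1)},\dots,v_{\pi(d)})$. For a kernel $M$ and an integer $r\ge 0$ let $\mathrm{Stk}^r(M)(v_1,\dots,v_{r+2})=M(v_1,v_2)$. A tensor $S$ of order $r+2$ is 2-PSD if it is continuous and $S(\cdot,\cdot,z)$ is a positive semidefinite kernel for every $z\in V^r$. Put $$C_r^V=\{M\in\mathcal K(V):\ \sigma(\mathrm{Stk}^r(M))=\sigma(N)\text{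 for some tensor }N\ge 0\text{ of order }r+2\},$$ $$Q_r^V=\{M\in\mathcal K(V):\ \sigma(\mathrm{Stk}^r(M))=\sigma(N)+\sigma(S)\text{ for some tensor }N\ge 0\text{ and some 2-PSD tensor }S,\text{ both of order }r+2\}.$$ For a set $\mathcal C\subseteq\mathcal K(V)$ consider the problem of minimizing $\lambda$ over all $K\in\mathcal C$ and $\lambda\in\mathbb R$ such that $K(v,v)=\lambda-1$ for all $v\in V$ and $K(u,v)=-1$ for all distinct nonadjacent $u,v\in V$. Let $\gamma_r(G)$ and $\nu_r(G)$ be its infimum in $[-\infty,+\infty]$ (with value $+\infty$ if infeasible) for $\mathcal C=C_r^V$ and $\mathcal C=Q_r^V$, respectively. Suppose that the problem with $\mathcal C=\mathrm{COP}(V)$ is strictly feasible, i.e. it has a feasible point $(K^+,\lambda^+)$ with $K^+\in\operatorname{int}\mathrm{COP}(V)$. Then the sequences $(\gamma_r(G))_{r\ge 0}$ and $(\nu_r(G))_{r\ge 0}$ are nonincreasing and both converge to $\alpha(G)$ as $r\to\infty$. -/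

import Mathlib

open Filter Topology
open scoped ENNReal

namespace CopKernel

/-! ### Kernels -/

/-- Kernels on `V`: symmetric continuous real functions on `V × V`. For compact `V` the topology
that this subspace inherits from `C(V × V, ℝ)` is the one of the supremum norm. -/
def Kernel (V : Type*) [TopologicalSpace V] : Submodule ℝ C(V × V, ℝ) where
  carrier := {F | ∀ x y : V, F (x, y) = F (y, x)}
  add_mem' := by
    intro F G hF hG x y
    simp [hF x y, hG x y]
  zero_mem' := by
    intro x y
    simp
  smul_mem' := by
    intro c F hF x y
    simp [hF x y]

/-- The restriction of a kernel to `U × U` for a finite `U ⊆ V`, as a matrix. -/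
def restrict {V : Type*} [TopologicalSpace V] (K : Kernel V) (U : Finset V) : Matrix U U ℝ :=
  Matrix.of fun u v => K.1 ((u : V), (v : V))

/-- A matrix is copositive if its quadratic form is nonnegative on the nonnegative orthant. -/
def IsCopositive {ι : Type*} [Fintype ι] (M : Matrix ι ι ℝ) : Prop :=
  ∀ x : ι → ℝ, (∀ i, 0 ≤ x i) → 0 ≤ ∑ i, ∑ j, M i j * x i * x j

/-- The cone of positive semidefinite kernels. -/
def psdCone (V : Type*) [TopologicalSpace V] : Set (Kernel V) :=
  {K | ∀ U : Finset V, (restrict K U).PosSemidef}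

/-- The cone `COP(V)` of copositive kernels. -/
def copCone (V : Type*) [TopologicalSpace V] : Set (Kernel V) :=
  {K | ∀ U : Finset V, IsCopositive (restrict K U)}

/-! ### Tensors -/

/-- A tensor of order `d` over `V`: a real function on `V ^ d`. -/
abbrev Tensor (V : Type*) (d : ℕ) : Type _ := (Fin d → V) → ℝ

/-- A kernel seen as a tensor of order two. -/
def toTensor {V : Type*} [TopologicalSpace V] (K : Kernel V) : Tensor V 2 :=
  fun v => K.1 (v 0, v 1)

/-- The `r`-stack: `stack r T (u, v) = T u` for `u ∈ V ^ d` and `v ∈ V ^ r`. -/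
def stack {V : Type*} {d : ℕ} (r : ℕ) (T : Tensor V d) : Tensor V (d + r) :=
  fun w => T fun i => w (Fin.castAdd r i)

/-- The symmetrization of a tensor: the average over all permutations of the arguments. -/
noncomputable def symmetrize {V : Type*} {d : ℕ} (T : Tensor V d) : Tensor V d :=
  fun v => (1 / (d.factorial : ℝ)) * ∑ π : Equiv.Perm (Fin d), T fun i => v (π i)

/-- A tensor is nonnegative if all its values are. No continuity is required. -/
def IsNonneg {V : Type*} {d : ℕ} (T : Tensor V d) : Prop :=
  ∀ v, 0 ≤ T v

/-- A tensor `F` of order `2 + r` is 2-PSD if it is continuous and, for each `z ∈ V ^ r`,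
the function `F(·, ·, z)` is a positive semidefinite kernel. -/
def IsTwoPSD {V : Type*} [TopologicalSpace V] {r : ℕ} (F : Tensor V (2 + r)) : Prop :=
  Continuous F ∧
    ∀ z : Fin r → V, ∃ K ∈ psdCone V, ∀ x y : V, K.1 (x, y) = F (Fin.append ![x, y] z)

/-! ### The two hierarchies -/

/-- The set `C_r^V`. -/
def coneC (V : Type*) [TopologicalSpace V] (r : ℕ) : Set (Kernel V) :=
  {M | ∃ N : Tensor V (2 + r), IsNonneg N ∧
    symmetrize (stack r (toTensor M)) = symmetrize N}

/-- The set `Q_r^V`. -/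
def coneQ (V : Type*) [TopologicalSpace V] (r : ℕ) : Set (Kernel V) :=
  {M | ∃ N S : Tensor V (2 + r), IsNonneg N ∧ IsTwoPSD S ∧
    symmetrize (stack r (toTensor M)) = symmetrize N + symmetrize S}

/-! ### Packing graphs and the optimization problems -/

/-- A topological packing graph: every finite clique is contained in an open clique. (That the
vertex space is compact and Hausdorff is expressed by type classes.) -/
def IsTopologicalPackingGraph {V : Type*} [TopologicalSpace V] (G : SimpleGraph V) : Prop :=
  ∀ s : Finset V, G.IsClique (s : Set V) → ∃ U : Set V, IsOpen U ∧ G.IsClique U ∧ (s : Set V) ⊆ U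

/-- The stability number: the supremum (in `ℕ∞`) of the cardinalities of finite stable sets. -/
noncomputable def stabilityNumber {V : Type*} (G : SimpleGraph V) : ℕ∞ :=
  ⨆ s : {s : Finset V // G.IsIndepSet (s : Set V)}, (s.1.card : ℕ∞)

/-- The pair `(K, l)` is feasible for the problem: minimize `l` subject to `K(v, v) = l - 1` for
all `v`, `K(u, v) = -1` for all distinct nonadjacent `u, v`, and `K ∈ C`. -/
def IsFeasible {V : Type*} [TopologicalSpace V] (G : SimpleGraph V) (C : Set (Kernel V))
    (K : Kernel V) (l : ℝ) : Prop :=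
  (∀ v : V, K.1 (v, v) = l - 1) ∧ (∀ u v : V, u ≠ v → ¬ G.Adj u v → K.1 (u, v) = -1) ∧ K ∈ C

/-- The infimum of that problem, in the extended reals (`⊤` if it is infeasible). -/
noncomputable def optValue {V : Type*} [TopologicalSpace V] (G : SimpleGraph V)
    (C : Set (Kernel V)) : EReal :=
  sInf {t : EReal | ∃ (K : Kernel V) (l : ℝ), IsFeasible G C K l ∧ t = (l : EReal)}

/-- The relaxation value `γ_r(G)`. -/
noncomputable def gammaVal {V : Type*} [TopologicalSpace V] (G : SimpleGraph V) (r : ℕ) : EReal :=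
  optValue G (coneC V r)

/-- The relaxation value `ν_r(G)`. -/
noncomputable def nuVal {V : Type*} [TopologicalSpace V] (G : SimpleGraph V) (r : ℕ) : EReal :=
  optValue G (coneQ V r)

/-- The copositive problem is strictly feasible: it has a feasible point whose kernel lies in the
interior, relative to the space of kernels, of the cone of copositive kernels. -/
def IsStrictlyFeasible {V : Type*} [TopologicalSpace V] (G : SimpleGraph V) : Prop :=
  ∃ (K : Kernel V) (l : ℝ), IsFeasible G (copCone V) K l ∧ K ∈ interior (copCone V)

end CopKernel

open CopKernel

namespace CopKernel

/-! ### Symmetrization -/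

/-! Monotonicity: appending one ignored argument to a certificate of level `r` gives one of level `r
+ 1`.

Lower bound: summing a certificate over all tuples from a finite stable set `s` removes the
symmetrizations and leaves `|s|^r` times the sum of `K` over `s × s`. That sum is `|s| l - |s|²`, so
`|s| ≤ l` (`sum_nonneg_of_mem_coneQ`, `IsFeasible.card_le`). The same inequality for the strictly
feasible point makes `α(G)` finite.

Upper bound: a weighted Motzkin–Straus inequality yields a copositive feasible `K` of value exactly
`α(G)` (`exists_isFeasible_copCone`). Moving it slightly towards the strictly feasible kernel costs
at most `δ` and leaves a kernel that is copositive even after subtracting a positive constant. Such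
a kernel lies in `coneC V r` for all large `r` (`exists_forall_mem_coneC`), and `coneC ⊆ coneQ`
carries the bound over to `ν_r`. -/

theorem symmetrize_comp_perm {V : Type*} {d : ℕ} (T : Tensor V d) (τ : Equiv.Perm (Fin d))
    (v : Fin d → V) : symmetrize T (fun i => v (τ i)) = symmetrize T v := by
  unfold symmetrize
  congr 1
  exact Fintype.sum_equiv (Equiv.mulLeft τ) _ _ fun π => rfl

theorem symmetrize_symmetrize {V : Type*} {d : ℕ} (T : Tensor V d) :
    symmetrize (symmetrize T) = symmetrize T := by
  funext v
  rw [symmetrize]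
  simp only [symmetrize_comp_perm, Finset.sum_const, Finset.card_univ, Fintype.card_perm,
    Fintype.card_fin, nsmul_eq_mul]
  have := d.factorial_ne_zero
  field_simp

theorem symmetrize_zero {V : Type*} {d : ℕ} : symmetrize (0 : Tensor V d) = 0 := by
  funext v
  simp [symmetrize]

theorem symmetrize_add {V : Type*} {d : ℕ} (S T : Tensor V d) :
    symmetrize (S + T) = symmetrize S + symmetrize T := by
  funext v
  simp [symmetrize, Finset.sum_add_distrib, mul_add]

/-- A permutation of the first `d` positions, extended by the identity, is absorbed by the average
over all permutations of `d + r` positions. -/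
theorem symmetrize_stack_symmetrize {V : Type*} {d r : ℕ} (T : Tensor V d) :
    symmetrize (stack r (symmetrize T)) = symmetrize (stack r T) := by
  funext v
  have key : ∀ ρ : Equiv.Perm (Fin d),
      ∑ π : Equiv.Perm (Fin (d + r)), T (fun i => v (π (Fin.castAdd r (ρ i)))) =
        ∑ π : Equiv.Perm (Fin (d + r)), T (fun i => v (π (Fin.castAdd r i))) := by
    intro ρ
    refine Fintype.sum_equiv
      (Equiv.mulRight (finSumFinEquiv.permCongr (Equiv.sumCongr ρ (Equiv.refl (Fin r))))) _ _ ?_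
    intro π
    simp [Equiv.permCongr_apply]
  simp only [symmetrize, stack]
  rw [← Finset.mul_sum, Finset.sum_comm]
  simp only [key, Finset.sum_const, Finset.card_univ, Fintype.card_perm,
    Fintype.card_fin, nsmul_eq_mul]
  have := d.factorial_ne_zero
  field_simp

theorem symmetrize_stack_succ {V : Type*} [TopologicalSpace V] (M : Kernel V) (r : ℕ) :
    symmetrize (stack (r + 1) (toTensor M)) =
      symmetrize (stack 1 (symmetrize (stack r (toTensor M)))) := by
  rw [symmetrize_stack_symmetrize]
  rfl

theorem stack_add {V : Type*} {d r : ℕ} (S T : Tensor V d) :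
    stack r (S + T) = stack r S + stack r T := rfl

theorem IsNonneg.stack {V : Type*} {d r : ℕ} {T : Tensor V d} (hT : IsNonneg T) :
    IsNonneg (stack r T) := fun _ => hT _

theorem IsTwoPSD.stack_one {V : Type*} [TopologicalSpace V] {r : ℕ} {S : Tensor V (2 + r)}
    (hS : IsTwoPSD S) : IsTwoPSD (r := r + 1) (stack 1 S) := by
  refine ⟨hS.1.comp (by fun_prop), fun z => ?_⟩
  obtain ⟨K, hK, h⟩ := hS.2 fun i => z i.castSucc
  refine ⟨K, hK, fun x y => (h x y).trans ?_⟩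
  unfold stack
  congr 1
  funext i
  refine Fin.addCases (fun j => ?_) (fun j => ?_) i
  · rw [Fin.append_left]
    exact (Fin.append_left ![x, y] z j).symm
  · rw [Fin.append_right]
    exact (Fin.append_right ![x, y] z j.castSucc).symm

/-! ### Inclusions between the cones -/

theorem coneC_subset_succ (V : Type*) [TopologicalSpace V] (r : ℕ) :
    coneC V r ⊆ coneC V (r + 1) := by
  rintro M ⟨N, hN, h⟩
  refine ⟨stack 1 N, hN.stack, ?_⟩
  rw [symmetrize_stack_succ, h, symmetrize_stack_symmetrize]

theorem coneQ_subset_succ (V : Type*) [TopologicalSpace V] (r : ℕ) :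
    coneQ V r ⊆ coneQ V (r + 1) := by
  rintro M ⟨N, S, hN, hS, h⟩
  refine ⟨stack 1 N, stack 1 S, hN.stack, hS.stack_one, ?_⟩
  rw [symmetrize_stack_succ, h, stack_add, symmetrize_add, symmetrize_stack_symmetrize,
    symmetrize_stack_symmetrize]

theorem zero_mem_psdCone (V : Type*) [TopologicalSpace V] : (0 : Kernel V) ∈ psdCone V := by
  intro U
  have : restrict (0 : Kernel V) U = 0 := by
    ext u v
    simp [restrict]
  rw [this]
  exact Matrix.PosSemidef.zero

theorem coneC_subset_coneQ (V : Type*) [TopologicalSpace V] (r : ℕ) :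
    coneC V r ⊆ coneQ V r := by
  rintro M ⟨N, hN, h⟩
  refine ⟨N, 0, hN, ⟨continuous_const, fun z => ⟨0, zero_mem_psdCone V, fun x y => by simp⟩⟩, ?_⟩
  rw [h, symmetrize_zero, add_zero]

theorem optValue_anti {V : Type*} [TopologicalSpace V] (G : SimpleGraph V) {C D : Set (Kernel V)}
    (h : C ⊆ D) : optValue G D ≤ optValue G C :=
  sInf_le_sInf fun _ ⟨K, l, hK, ht⟩ => ⟨K, l, ⟨hK.1, hK.2.1, h hK.2.2⟩, ht⟩

/-! ### Summation over a finite set and the lower bound -/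

theorem sum_symmetrize {V : Type*} {d : ℕ} (T : Tensor V d) (s : Finset V) :
    ∑ v : Fin d → s, symmetrize T (fun i => (v i : V)) = ∑ v : Fin d → s, T fun i => (v i : V) := by
  have key : ∀ π : Equiv.Perm (Fin d), ∑ v : Fin d → s, T (fun i => (v (π i) : V)) =
      ∑ v : Fin d → s, T fun i => (v i : V) := fun π =>
    Fintype.sum_equiv (Equiv.arrowCongr π.symm (Equiv.refl _)) _ _ fun v => rfl
  simp only [symmetrize]
  rw [← Finset.mul_sum, Finset.sum_comm]
  simp only [key, Finset.sum_const, Finset.card_univ, Fintype.card_perm,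
    Fintype.card_fin, nsmul_eq_mul]
  have := d.factorial_ne_zero
  field_simp

theorem sum_tuple_eq_sum_append {V : Type*} {r : ℕ} (T : Tensor V (2 + r)) (s : Finset V) :
    ∑ v : Fin (2 + r) → s, T (fun i => (v i : V)) =
      ∑ z : Fin r → s, ∑ a : s, ∑ b : s, T (Fin.append ![(a : V), (b : V)] fun i => (z i : V)) := by
  rw [← (Fin.appendEquiv 2 r).sum_comp, Fintype.sum_prod_type_right]
  refine Finset.sum_congr rfl fun z _ => ?_
  rw [← (finTwoArrowEquiv s).symm.sum_comp, Fintype.sum_prod_type]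
  refine Finset.sum_congr rfl fun a _ => Finset.sum_congr rfl fun b _ => ?_
  congr 1
  funext i
  refine Fin.addCases (fun j => ?_) (fun j => ?_) i
  · fin_cases j <;> simp [Fin.appendEquiv]
  · simp [Fin.appendEquiv]

theorem sum_nonneg_of_mem_copCone {V : Type*} [TopologicalSpace V] {M : Kernel V}
    (hM : M ∈ copCone V) (s : Finset V) : 0 ≤ ∑ a : s, ∑ b : s, M.1 ((a : V), (b : V)) := by
  simpa [restrict] using hM s (fun _ => 1) fun _ => zero_le_one

theorem sum_nonneg_of_mem_psdCone {V : Type*} [TopologicalSpace V] {M : Kernel V}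
    (hM : M ∈ psdCone V) (s : Finset V) : 0 ≤ ∑ a : s, ∑ b : s, M.1 ((a : V), (b : V)) := by
  have := (hM s).dotProduct_mulVec_nonneg (fun _ => 1)
  simpa [restrict, dotProduct, Matrix.mulVec] using this

theorem sum_nonneg_of_mem_coneQ {V : Type*} [TopologicalSpace V] {M : Kernel V} {r : ℕ}
    (hM : M ∈ coneQ V r) (s : Finset V) : 0 ≤ ∑ a : s, ∑ b : s, M.1 ((a : V), (b : V)) := by
  obtain ⟨N, S, hN, hS, h⟩ := hM
  rcases s.eq_empty_or_nonempty with rfl | hs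
  · simp
  have h1 := sum_symmetrize (stack r (toTensor M)) s
  rw [h] at h1
  simp only [Pi.add_apply, Finset.sum_add_distrib] at h1
  rw [sum_symmetrize, sum_symmetrize, sum_tuple_eq_sum_append S,
    sum_tuple_eq_sum_append (stack r _)] at h1
  have hstack : ∀ (z : Fin r → s) (a b : s),
      stack r (toTensor M) (Fin.append ![(a : V), (b : V)] fun i => (z i : V)) =
        M.1 ((a : V), (b : V)) := by
    intro z a b
    simp only [stack, toTensor, Fin.append_left]
    rfl
  simp only [hstack, Finset.sum_const, nsmul_eq_mul] at h1
  have hS' : 0 ≤ ∑ z : Fin r → s, ∑ a : s, ∑ b : s,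
      S (Fin.append ![(a : V), (b : V)] fun i => (z i : V)) := by
    refine Finset.sum_nonneg fun z _ => ?_
    obtain ⟨K, hK, hKS⟩ := hS.2 fun i => (z i : V)
    simpa only [hKS] using sum_nonneg_of_mem_psdCone hK s
  have hN' : 0 ≤ ∑ v : Fin (2 + r) → s, N (fun i => (v i : V)) :=
    Finset.sum_nonneg fun v _ => hN _
  have hpos : (0 : ℝ) < ((Finset.univ : Finset (Fin r → s)).card : ℝ) := by
    have : Nonempty s := hs.to_subtype
    exact_mod_cast Finset.card_pos.2 Finset.univ_nonempty
  exact nonneg_of_mul_nonneg_right (h1 ▸ add_nonneg hN' hS') hpos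

theorem IsFeasible.card_le {V : Type*} [TopologicalSpace V] {G : SimpleGraph V}
    {C : Set (Kernel V)} {K : Kernel V} {l : ℝ} (hK : IsFeasible G C K l) {s : Finset V}
    (hs : G.IsIndepSet (s : Set V)) (hne : s.Nonempty)
    (h : 0 ≤ ∑ a : s, ∑ b : s, K.1 ((a : V), (b : V))) : (s.card : ℝ) ≤ l := by
  classical
  have hval : ∀ a b : s, K.1 ((a : V), (b : V)) = (if a = b then l else 0) - 1 := by
    intro a b
    by_cases hab : a = b
    · subst hab
      simp [hK.1]
    · have hne : (a : V) ≠ b := fun h => hab (Subtype.ext h)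
      simp [hab, hK.2.1 _ _ hne (hs a.2 b.2 hne)]
  have hc : (0 : ℝ) < s.card := by exact_mod_cast hne.card_pos
  simp only [hval, Finset.sum_sub_distrib, Finset.sum_ite_eq, Finset.mem_univ, if_true,
    Finset.sum_const, Finset.card_univ, Fintype.card_coe, nsmul_eq_mul, mul_one] at h
  nlinarith

theorem coe_le_of_forall_card_le {V : Type*} [Nonempty V] {G : SimpleGraph V} {n : ℕ} {l : ℝ}
    (hn : stabilityNumber G = n)
    (h : ∀ s : Finset V, G.IsIndepSet (s : Set V) → s.Nonempty → (s.card : ℝ) ≤ l) :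
    (n : ℝ) ≤ l := by
  have hfl : stabilityNumber G ≤ (⌊l⌋₊ : ℕ∞) := by
    refine iSup_le fun ⟨s, hs⟩ => ?_
    rcases s.eq_empty_or_nonempty with rfl | hne
    · simp
    · exact_mod_cast Nat.le_floor (h s hs hne)
  -- The natural floor is `0` for negative `l`, so a one-point stable set is needed to exclude that
  -- case.
  have hl : 0 ≤ l := by
    obtain ⟨v⟩ := ‹Nonempty V›
    have := h {v} (by simp) (Finset.singleton_nonempty v)
    simp at this
    linarith
  rw [hn, Nat.cast_le] at hfl
  exact (Nat.cast_le.2 hfl).trans (Nat.floor_le hl)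

theorem stabilityNumber_ne_top {V : Type*} {G : SimpleGraph V} {l : ℝ}
    (h : ∀ s : Finset V, G.IsIndepSet (s : Set V) → s.Nonempty → (s.card : ℝ) ≤ l) :
    stabilityNumber G ≠ ⊤ := by
  refine ne_top_of_le_ne_top (ENat.natCast_ne_top ⌊l⌋₊) (iSup_le fun ⟨s, hs⟩ => ?_)
  rcases s.eq_empty_or_nonempty with rfl | hne
  · simp
  · exact_mod_cast Nat.le_floor (h s hs hne)

/-! ### Copositive kernels -/

theorem mem_copCone_iff {V : Type*} [TopologicalSpace V] {K : Kernel V} :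
    K ∈ copCone V ↔ ∀ (s : Finset V) (x : V → ℝ), (∀ a, 0 ≤ x a) →
      0 ≤ ∑ a ∈ s, ∑ b ∈ s, K.1 (a, b) * x a * x b := by
  classical
  constructor
  · intro h s x hx
    have := h s (fun a => x a) fun a => hx a
    simpa only [restrict, Matrix.of_apply, ← Finset.sum_coe_sort s] using this
  · intro h s x hx
    have := h s (fun a => if ha : a ∈ s then x ⟨a, ha⟩ else 0) fun a => by
      split_ifs
      exacts [hx _, le_rfl]
    simpa [restrict, ← Finset.sum_coe_sort s] using this

/-- Repeated entries of the tuple become multiplicities, used as nonnegative weights on its image.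
-/
theorem sum_tuple_nonneg_of_mem_copCone {V : Type*} [TopologicalSpace V] {K : Kernel V}
    (hK : K ∈ copCone V) {n : ℕ} (v : Fin n → V) : 0 ≤ ∑ i, ∑ j, K.1 (v i, v j) := by
  classical
  have hsum : ∀ g : V → ℝ, ∑ i, g (v i) =
      ∑ u ∈ Finset.univ.image v, (((Finset.univ.filter fun i => v i = u).card : ℕ) : ℝ) * g u := by
    intro g
    rw [Finset.sum_comp g v]
    simp only [nsmul_eq_mul]
  have := mem_copCone_iff.1 hK (Finset.univ.image v)
    (fun u => ((Finset.univ.filter fun i => v i = u).card : ℝ)) fun _ => Nat.cast_nonneg _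
  rw [hsum fun a => ∑ j, K.1 (a, v j)]
  refine this.trans_eq (Finset.sum_congr rfl fun a _ => ?_)
  rw [hsum fun b => K.1 (a, b), Finset.mul_sum]
  exact Finset.sum_congr rfl fun b _ => by ring

theorem add_mem_copCone {V : Type*} [TopologicalSpace V] {K L : Kernel V} (hK : K ∈ copCone V)
    (hL : L ∈ copCone V) : K + L ∈ copCone V := by
  rw [mem_copCone_iff] at *
  intro s x hx
  refine (add_nonneg (hK s x hx) (hL s x hx)).trans_eq ?_
  simp [← Finset.sum_add_distrib, add_mul]

theorem smul_mem_copCone {V : Type*} [TopologicalSpace V] {K : Kernel V} (hK : K ∈ copCone V)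
    {c : ℝ} (hc : 0 ≤ c) : c • K ∈ copCone V := by
  rw [mem_copCone_iff] at *
  intro s x hx
  refine (mul_nonneg hc (hK s x hx)).trans_eq ?_
  simp [Finset.mul_sum, mul_assoc]

/-- The kernel that is constantly one. -/
def oneKernel (V : Type*) [TopologicalSpace V] : Kernel V := ⟨1, fun _ _ => rfl⟩

theorem exists_sub_smul_oneKernel_mem {V : Type*} [TopologicalSpace V] [CompactSpace V]
    {K : Kernel V} (hK : K ∈ interior (copCone V)) :
    ∃ ε : ℝ, 0 < ε ∧ K - ε • oneKernel V ∈ copCone V := by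
  have hc : ContinuousAt (fun ε : ℝ => K - ε • oneKernel V) 0 := by fun_prop
  have h0 : copCone V ∈ 𝓝 (K - (0 : ℝ) • oneKernel V) := by
    rw [zero_smul, sub_zero]
    exact mem_interior_iff_mem_nhds.1 hK
  obtain ⟨δ, hδ, h⟩ := Metric.mem_nhds_iff.1 (hc h0)
  refine ⟨δ / 2, half_pos hδ, h ?_⟩
  simp only [Metric.mem_ball, Real.dist_eq, sub_zero]
  rw [abs_of_pos (half_pos hδ)]
  exact half_lt_self hδ

/-! ### Kernels in the interior lie in the cones of the hierarchy -/

/-- The symmetric group is 2-transitive, so the symmetrized stack at `v` is the average of `K (v i,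
v j)` over pairs `i ≠ j`. -/
theorem symmetrize_stack_nonneg {V : Type*} [TopologicalSpace V] {K : Kernel V} {r : ℕ}
    (h : ∀ v : Fin (2 + r) → V, 0 ≤ ∑ p ∈ Finset.univ.offDiag, K.1 (v p.1, v p.2))
    (v : Fin (2 + r) → V) : 0 ≤ symmetrize (stack r (toTensor K)) v := by
  set a : Fin (2 + r) := Fin.castAdd r 0
  set b : Fin (2 + r) := Fin.castAdd r 1
  have hab : a ≠ b := fun h => by simpa [a, b] using congrArg Fin.val h
  have key : ∀ p ∈ (Finset.univ : Finset (Fin (2 + r))).offDiag,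
      ∑ π : Equiv.Perm (Fin (2 + r)), K.1 (v (π p.1), v (π p.2)) =
        ∑ π : Equiv.Perm (Fin (2 + r)), K.1 (v (π a), v (π b)) := by
    intro p hp
    obtain ⟨τ, h1, h2⟩ := MulAction.is_two_pretransitive_iff.1
      (Equiv.Perm.isMultiplyPretransitive (Fin (2 + r)) 2) hab (Finset.mem_offDiag.1 hp).2.2
    rw [← h1, ← h2]
    exact Fintype.sum_equiv (Equiv.mulRight τ) _ _ fun π => rfl
  have h1 : 0 ≤ ∑ π : Equiv.Perm (Fin (2 + r)), ∑ p ∈ Finset.univ.offDiag,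
      K.1 (v (π p.1), v (π p.2)) := Finset.sum_nonneg fun π _ => h fun i => v (π i)
  rw [Finset.sum_comm, Finset.sum_congr rfl key, Finset.sum_const, nsmul_eq_mul] at h1
  have hpos : (0 : ℝ) < ((Finset.univ : Finset (Fin (2 + r))).offDiag.card : ℝ) := by
    exact_mod_cast Finset.card_pos.2 ⟨(a, b), by simpa using hab⟩
  exact mul_nonneg (by positivity) (nonneg_of_mul_nonneg_right h1 hpos)

/-- With `d = 2 + r`, the full sum over a `d`-tuple is at least `ε d²`, while its diagonal part is
at most `d ‖K‖`. Once `d ε ≥ ‖K‖` the off-diagonal part is nonnegative, and the symmetrized stack is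
its own certificate. -/
theorem exists_forall_mem_coneC {V : Type*} [TopologicalSpace V] [CompactSpace V]
    {K : Kernel V} {ε : ℝ} (hε : 0 < ε) (hK : K - ε • oneKernel V ∈ copCone V) :
    ∃ r₀ : ℕ, ∀ r ≥ r₀, K ∈ coneC V r := by
  obtain ⟨r₀, hr₀⟩ := exists_nat_ge (‖K.1‖ / ε)
  refine ⟨r₀, fun r hr => ⟨symmetrize (stack r (toTensor K)),
    symmetrize_stack_nonneg fun v => ?_, (symmetrize_symmetrize _).symm⟩⟩
  have h1 := sum_tuple_nonneg_of_mem_copCone hK v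
  have hone : ∀ p, (K - ε • oneKernel V).1 p = K.1 p - ε := fun p => by simp [oneKernel]
  simp only [hone, Finset.sum_sub_distrib, Finset.sum_const, Finset.card_univ, Fintype.card_fin,
    nsmul_eq_mul] at h1
  have h2 : ∑ i, ∑ j, K.1 (v i, v j) =
      ∑ i, K.1 (v i, v i) + ∑ p ∈ Finset.univ.offDiag, K.1 (v p.1, v p.2) := by
    rw [← Finset.sum_product', ← Finset.diag_union_offDiag,
      Finset.sum_union (Finset.disjoint_diag_offDiag _), Finset.sum_diag]
  have h3 : ∑ i, K.1 (v i, v i) ≤ ((2 + r : ℕ) : ℝ) * ‖K.1‖ := by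
    refine (Finset.sum_le_card_nsmul _ _ ‖K.1‖ fun i _ => ?_).trans_eq (by simp)
    exact (le_abs_self _).trans (K.1.norm_coe_le_norm _)
  have h4 : ‖K.1‖ ≤ ((2 + r : ℕ) : ℝ) * ε := by
    rw [div_le_iff₀ hε] at hr₀
    refine hr₀.trans (mul_le_mul_of_nonneg_right ?_ hε.le)
    exact_mod_cast hr.trans (Nat.le_add_left r 2)
  have h5 := mul_le_mul_of_nonneg_left h4 (Nat.cast_nonneg (α := ℝ) (2 + r))
  linarith

/-! ### A weighted Motzkin–Straus inequality -/

/-- Induction on `n`. For `u` of least weighted degree, split `s` into `N`, where `A u = 1`, and the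
rest `R`. Adding `u` to an independent subset of `R` keeps it independent, so `R` satisfies the
hypothesis for `n`. Each degree is at least the weight `m` of `N`, so the form is at least `m² + Q`,
with `Q` the form on `R`. -/
theorem sq_sum_le_mul_sum {V : Type*} {A : V → V → ℝ} (hA : ∀ a b, 0 ≤ A a b)
    (hsymm : ∀ a b, A a b = A b a) (hdiag : ∀ a, A a a = 1) {x : V → ℝ} (hx : ∀ a, 0 ≤ x a)
    (n : ℕ) (s : Finset V)
    (hs : ∀ t ⊆ s, (∀ a ∈ t, ∀ b ∈ t, a ≠ b → A a b ≠ 1) → t.card ≤ n) :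
    (∑ a ∈ s, x a) ^ 2 ≤ n * ∑ a ∈ s, ∑ b ∈ s, A a b * x a * x b := by
  classical
  induction n generalizing s with
  | zero =>
    rcases s.eq_empty_or_nonempty with rfl | ⟨u, hu⟩
    · simp
    · have := hs {u} (by simpa using hu) (by simp)
      simp at this
  | succ n ih =>
    rcases s.eq_empty_or_nonempty with rfl | hne
    · simp
    obtain ⟨u, hu, hmin⟩ := s.exists_min_image (fun a => ∑ b ∈ s, A a b * x b) hne
    set N := s.filter fun a => A u a = 1 with hN
    set R := s.filter fun a => ¬ A u a = 1 with hR
    have hsplit : ∀ g : V → ℝ, ∑ a ∈ s, g a = ∑ a ∈ N, g a + ∑ a ∈ R, g a := fun g =>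
      (Finset.sum_filter_add_sum_filter_not s _ g).symm
    have hRn := ih R fun t ht hind => by
      have hut : u ∉ t := fun h => (Finset.mem_filter.1 (ht h)).2 (hdiag u)
      have := hs (insert u t)
        (Finset.insert_subset hu (ht.trans (Finset.filter_subset _ _))) (by
          intro a ha b hb hab
          rcases Finset.mem_insert.1 ha with hau | hat <;>
            rcases Finset.mem_insert.1 hb with hbu | hbt
          · exact absurd (hau.trans hbu.symm) hab
          · rw [hau]
            exact (Finset.mem_filter.1 (ht hbt)).2
          · rw [hbu, hsymm]
            exact (Finset.mem_filter.1 (ht hat)).2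
          · exact hind a hat b hbt hab)
      rw [Finset.card_insert_of_notMem hut] at this
      omega
    set m := ∑ a ∈ N, x a with hm
    have hm0 : 0 ≤ m := Finset.sum_nonneg fun a _ => hx a
    have hdeg : ∀ a ∈ s, m ≤ ∑ b ∈ s, A a b * x b := by
      intro a ha
      refine le_trans ?_ (hmin a ha)
      rw [hsplit]
      refine le_add_of_le_of_nonneg (Finset.sum_le_sum fun b hb => ?_)
        (Finset.sum_nonneg fun b _ => mul_nonneg (hA _ _) (hx b))
      rw [(Finset.mem_filter.1 hb).2, one_mul]
    set Q := ∑ a ∈ R, ∑ b ∈ R, A a b * x a * x b with hQ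
    have hterm : ∀ a b, 0 ≤ A a b * x a * x b := fun a b =>
      mul_nonneg (mul_nonneg (hA a b) (hx a)) (hx b)
    have hQ0 : 0 ≤ Q := Finset.sum_nonneg fun a _ => Finset.sum_nonneg fun b _ => hterm a b
    have htotal : m * m + Q ≤ ∑ a ∈ s, ∑ b ∈ s, A a b * x a * x b := by
      rw [hsplit fun a => ∑ b ∈ s, A a b * x a * x b]
      refine add_le_add ?_ (Finset.sum_le_sum fun a _ =>
        Finset.sum_le_sum_of_subset_of_nonneg (Finset.filter_subset _ _) fun b _ _ => hterm a b)
      rw [hm, Finset.sum_mul]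
      refine Finset.sum_le_sum fun a ha => ?_
      refine (mul_le_mul_of_nonneg_left (hdeg a (Finset.mem_filter.1 ha).1) (hx a)).trans_eq ?_
      rw [Finset.mul_sum]
      exact Finset.sum_congr rfl fun b _ => by ring
    refine le_trans ?_ (mul_le_mul_of_nonneg_left htotal (Nat.cast_nonneg _))
    rw [hsplit, ← hm]
    set y := ∑ a ∈ R, x a
    -- The bound `2my ≤ n m² + y²/n` divides by `n`; for `n = 0` the induction hypothesis forces `y
    -- = 0`.
    rcases n.eq_zero_or_pos with rfl | hpos
    · have hy : y = 0 := by
        have : y ^ 2 ≤ 0 := by simpa using hRn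
        exact pow_eq_zero_iff two_ne_zero |>.1 (le_antisymm this (sq_nonneg _))
      rw [hy]
      push_cast
      nlinarith
    · have hn : (0 : ℝ) < n := by exact_mod_cast hpos
      have h2 : 2 * (m * y) ≤ n * m ^ 2 + Q := by
        refine le_of_mul_le_mul_left ?_ hn
        nlinarith [sq_nonneg (n * m - y)]
      push_cast
      nlinarith

/-! ### An optimal copositive kernel -/

theorem IsTopologicalPackingGraph.isOpen_adj_or_eq {V : Type*} [TopologicalSpace V]
    {G : SimpleGraph V} (hG : IsTopologicalPackingGraph G) :
    IsOpen {p : V × V | p.1 = p.2 ∨ G.Adj p.1 p.2} := by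
  classical
  rw [isOpen_iff_mem_nhds]
  rintro ⟨u, v⟩ huv
  obtain ⟨U, hU, hcl, hsub⟩ := hG {u, v} (by
    simp only [Finset.coe_insert, Finset.coe_singleton, SimpleGraph.isClique_pair]
    exact fun h => huv.resolve_left h)
  refine mem_of_superset ((hU.prod hU).mem_nhds ⟨hsub (by simp), hsub (by simp)⟩) ?_
  rintro ⟨a, b⟩ ⟨ha, hb⟩
  by_cases hab : a = b
  · exact Or.inl hab
  · exact Or.inr (hcl ha hb hab)

/-- The open relation "equal or adjacent" is shrunk to a closed one without creating larger
independent sets, leaving room for a Urysohn function. -/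
theorem exists_isClosed_subset_adj {V : Type*} [TopologicalSpace V] [CompactSpace V] [T2Space V]
    {G : SimpleGraph V} {n : ℕ} (hG : IsTopologicalPackingGraph G)
    (hn : ∀ s : Finset V, G.IsIndepSet (s : Set V) → s.card ≤ n) :
    ∃ C : Set (V × V), IsClosed C ∧ C ⊆ {p | p.1 = p.2 ∨ G.Adj p.1 p.2} ∧ (∀ v, (v, v) ∈ C) ∧
      ∀ s : Finset V, (∀ a ∈ s, ∀ b ∈ s, a ≠ b → (a, b) ∉ C) → s.card ≤ n := by
  classical
  set E : Set (V × V) := {p | p.1 = p.2 ∨ G.Adj p.1 p.2} with hE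
  let ι := {p : Fin (n + 1) × Fin (n + 1) // p.1 ≠ p.2}
  let pr : ι → (Fin (n + 1) → V) → V × V := fun p w => (w p.1.1, w p.1.2)
  have hpr : ∀ p, Continuous (pr p) := fun p => by fun_prop
  -- Every `(n + 1)`-tuple has two equal or adjacent entries. This finite open cover of the compact
  -- space `V ^ (n + 1)` shrinks to a closed cover, whose projections to `V × V` are compact.
  have hcover : ⋃ p : ι, pr p ⁻¹' E = Set.univ := by
    refine Set.eq_univ_of_forall fun w => ?_
    by_contra hw
    simp only [Set.mem_iUnion, not_exists] at hw
    have hinj : Function.Injective w := fun i j hij => by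
      by_contra hne
      exact hw ⟨(i, j), hne⟩ (Or.inl hij)
    have := hn (Finset.univ.image w) (by
      intro a ha b hb hab hadj
      simp only [Finset.coe_image, Finset.coe_univ, Set.image_univ, Set.mem_range] at ha hb
      obtain ⟨i, rfl⟩ := ha
      obtain ⟨j, rfl⟩ := hb
      exact hw ⟨(i, j), fun h => hab (congrArg w h)⟩ (Or.inr hadj))
    rw [Finset.card_image_of_injective _ hinj] at this
    simp at this
  obtain ⟨F, hF, hFc, hFs⟩ := exists_iUnion_eq_closed_subset
    (fun p => hG.isOpen_adj_or_eq.preimage (hpr p)) (fun _ => Set.toFinite _) hcover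
  refine ⟨Set.diagonal V ∪ ⋃ p : ι, pr p '' F p, isClosed_diagonal.union
    (isClosed_iUnion_of_finite fun p => ((hFc p).isCompact.image (hpr p)).isClosed), ?_,
    fun v => Or.inl rfl, ?_⟩
  · refine Set.union_subset (fun p hp => Or.inl hp) (Set.iUnion_subset fun p => ?_)
    rintro _ ⟨w, hw, rfl⟩
    exact hFs p hw
  · intro s hs
    by_contra! hcard
    obtain ⟨t, hts, ht⟩ := Finset.exists_subset_card_eq (Nat.succ_le_of_lt hcard)
    let w : Fin (n + 1) → V := fun i => (t.equivFinOfCardEq ht).symm i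
    have hw : w ∈ ⋃ p, F p := hF ▸ Set.mem_univ w
    obtain ⟨p, hp⟩ := Set.mem_iUnion.1 hw
    refine hs (w p.1.1) (hts (Subtype.prop _)) (w p.1.2) (hts (Subtype.prop _)) (fun h => ?_)
      (Or.inr (Set.mem_iUnion.2 ⟨p, w, hp, rfl⟩))
    exact p.2 ((t.equivFinOfCardEq ht).symm.injective (Subtype.ext h))

/-- The kernel is `n A - 1`, with `A` a continuous adjacency weight equal to `1` on `C` and `0` on
distinct nonadjacent pairs; its copositivity is exactly `sq_sum_le_mul_sum`. -/
theorem exists_isFeasible_copCone {V : Type*} [TopologicalSpace V] [CompactSpace V] [T2Space V]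
    {G : SimpleGraph V} {n : ℕ} (hG : IsTopologicalPackingGraph G)
    (hn : ∀ s : Finset V, G.IsIndepSet (s : Set V) → s.card ≤ n) :
    ∃ K : Kernel V, IsFeasible G (copCone V) K n := by
  obtain ⟨C, hC, hCE, hdiag, hCn⟩ := exists_isClosed_subset_adj hG hn
  obtain ⟨f, hf0, hf1, hf⟩ := exists_continuous_zero_one_of_isClosed
    hG.isOpen_adj_or_eq.isClosed_compl hC (Set.disjoint_compl_left_iff_subset.2 hCE)
  -- The Urysohn function need not be symmetric; the maximum makes it so and keeps the values `0`
  -- and `1` where they are needed.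
  let A : V → V → ℝ := fun a b => max (f (a, b)) (f (b, a))
  have hA1 : ∀ a b, (a, b) ∈ C → A a b = 1 := fun a b h =>
    le_antisymm (max_le (hf _).2 (hf _).2) ((hf1 h).symm.le.trans (le_max_left _ _))
  have hA0 : ∀ a b, a ≠ b → ¬ G.Adj a b → A a b = 0 := by
    intro a b hab hadj
    have h1 : f (a, b) = 0 := hf0 (fun h => h.elim hab hadj)
    have h2 : f (b, a) = 0 := hf0 (fun h => h.elim (Ne.symm hab) fun h => hadj h.symm)
    simp [A, h1, h2]
  have hAsymm : ∀ a b, A a b = A b a := fun a b => max_comm _ _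
  let K : Kernel V := ⟨⟨fun p => n * A p.1 p.2 - 1, by fun_prop⟩, fun a b => by
    simp [hAsymm a b]⟩
  have hK : ∀ a b, K.1 (a, b) = n * A a b - 1 := fun _ _ => rfl
  refine ⟨K, fun v => ?_, fun u v huv hadj => ?_, mem_copCone_iff.2 fun s x hx => ?_⟩
  · rw [hK, hA1 v v (hdiag v), mul_one]
  · rw [hK, hA0 u v huv hadj, mul_zero, zero_sub]
  · have := sq_sum_le_mul_sum (A := A) (fun a b => (hf _).1.trans (le_max_left _ _)) hAsymm
      (fun a => hA1 a a (hdiag a)) hx n s fun t _ ht =>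
        hCn t fun a ha b hb hab h => ht a ha b hb hab (hA1 a b h)
    have heq : ∑ a ∈ s, ∑ b ∈ s, K.1 (a, b) * x a * x b =
        n * ∑ a ∈ s, ∑ b ∈ s, A a b * x a * x b - (∑ a ∈ s, x a) ^ 2 := by
      simp only [hK, sub_mul, one_mul, Finset.sum_sub_distrib, mul_assoc, ← Finset.mul_sum,
        sq, Finset.sum_mul_sum]
    rw [heq]
    exact sub_nonneg.2 this

/-! ### Convergence -/

theorem IsFeasible.exists_forall_optValue_le {V : Type*} [TopologicalSpace V] [CompactSpace V]
    {G : SimpleGraph V} {K L : Kernel V} {k l : ℝ} (hK : IsFeasible G (copCone V) K k)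
    (hL : IsFeasible G (copCone V) L l) (hint : L ∈ interior (copCone V)) {t : ℝ} (ht0 : 0 < t)
    (ht1 : t ≤ 1) :
    ∃ r₀ : ℕ, ∀ r ≥ r₀, gammaVal G r ≤ (((1 - t) * k + t * l : ℝ) : EReal) := by
  obtain ⟨ε, hε, hLε⟩ := exists_sub_smul_oneKernel_mem hint
  obtain ⟨r₀, hr₀⟩ := exists_forall_mem_coneC (K := (1 - t) • K + t • L) (mul_pos ht0 hε) (by
    have := add_mem_copCone (smul_mem_copCone hK.2.2 (sub_nonneg.2 ht1))
      (smul_mem_copCone hLε ht0.le)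
    rwa [smul_sub, smul_smul, ← add_sub_assoc] at this)
  refine ⟨r₀, fun r hr => sInf_le ⟨_, _, ⟨fun v => ?_, fun u v huv hadj => ?_, hr₀ r hr⟩, rfl⟩⟩
  · have h1 := hK.1 v
    have h2 := hL.1 v
    simp only [Submodule.coe_add, Submodule.coe_smul, ContinuousMap.add_apply,
      ContinuousMap.smul_apply, smul_eq_mul, h1, h2]
    ring
  · have h1 := hK.2.1 u v huv hadj
    have h2 := hL.2.1 u v huv hadj
    simp only [Submodule.coe_add, Submodule.coe_smul, ContinuousMap.add_apply,
      ContinuousMap.smul_apply, smul_eq_mul, h1, h2]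
    ring

theorem exists_forall_gammaVal_le {V : Type*} [TopologicalSpace V] [CompactSpace V] [T2Space V]
    {G : SimpleGraph V} {n : ℕ} (hG : IsTopologicalPackingGraph G) (hfeas : IsStrictlyFeasible G)
    (hn : ∀ s : Finset V, G.IsIndepSet (s : Set V) → s.card ≤ n) {δ : ℝ} (hδ : 0 < δ) :
    ∃ r₀ : ℕ, ∀ r ≥ r₀, gammaVal G r ≤ ((n + δ : ℝ) : EReal) := by
  obtain ⟨K, hK⟩ := exists_isFeasible_copCone hG hn
  obtain ⟨L, l, hL, hint⟩ := hfeas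
  have hpos : 0 < δ + |l - n| := by positivity
  -- This weight `t` on the strictly feasible point satisfies `0 < t ≤ 1` and `t (l - n) ≤ δ`.
  have ht1 : δ / (δ + |l - n|) ≤ 1 := (div_le_one hpos).2 (by linarith [abs_nonneg (l - n)])
  obtain ⟨r₀, h⟩ := hK.exists_forall_optValue_le hL hint (div_pos hδ hpos) ht1
  refine ⟨r₀, fun r hr => (h r hr).trans (EReal.coe_le_coe_iff.2 ?_)⟩
  have : δ / (δ + |l - n|) * (l - n) ≤ δ := by
    rw [div_mul_eq_mul_div, div_le_iff₀ hpos]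
    exact mul_le_mul_of_nonneg_left (by linarith [le_abs_self (l - n)]) hδ.le
  linarith

theorem coe_le_nuVal {V : Type*} [TopologicalSpace V] [Nonempty V] {G : SimpleGraph V} {n : ℕ}
    (hn : stabilityNumber G = n) (r : ℕ) : ((n : ℝ) : EReal) ≤ nuVal G r := by
  refine le_sInf ?_
  rintro _ ⟨K, l, hK, rfl⟩
  exact EReal.coe_le_coe_iff.2 (coe_le_of_forall_card_le hn fun s hs hne =>
    hK.card_le hs hne (sum_nonneg_of_mem_coneQ hK.2.2 s))

theorem nuVal_le_gammaVal {V : Type*} [TopologicalSpace V] (G : SimpleGraph V) (r : ℕ) :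
    nuVal G r ≤ gammaVal G r := optValue_anti G (coneC_subset_coneQ V r)

theorem tendsto_of_forall_le_add {u : ℕ → EReal} {a : ℝ} (hl : ∀ r, (a : EReal) ≤ u r)
    (hu : ∀ δ : ℝ, 0 < δ → ∃ r₀ : ℕ, ∀ r ≥ r₀, u r ≤ ((a + δ : ℝ) : EReal)) :
    Tendsto u atTop (𝓝 (a : EReal)) := by
  refine tendsto_order.2 ⟨fun b hb => Eventually.of_forall fun r => hb.trans_le (hl r),
    fun b hb => ?_⟩
  obtain ⟨c, hac, hcb⟩ := EReal.lt_iff_exists_real_btwn.1 hb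
  obtain ⟨r₀, h⟩ := hu (c - a) (sub_pos.2 (EReal.coe_lt_coe_iff.1 hac))
  filter_upwards [eventually_ge_atTop r₀] with r hr
  refine (h r hr).trans_lt ?_
  rwa [add_sub_cancel]

end CopKernel

open CopKernel
theorem theorem2 {V : Type*} [TopologicalSpace V] [CompactSpace V] [T2Space V] [Nonempty V]
    (G : SimpleGraph V) (hG : IsTopologicalPackingGraph G) (hfeas : IsStrictlyFeasible G) :
    (Antitone (gammaVal G) ∧
      Tendsto (gammaVal G) atTop (𝓝 (((stabilityNumber G : ℕ∞) : ℝ≥0∞) : EReal))) ∧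
    (Antitone (nuVal G) ∧
      Tendsto (nuVal G) atTop (𝓝 (((stabilityNumber G : ℕ∞) : ℝ≥0∞) : EReal))) := by
  have htop : stabilityNumber G ≠ ⊤ := by
    obtain ⟨L, l, hL, -⟩ := hfeas
    exact stabilityNumber_ne_top fun s hs hne =>
      hL.card_le hs hne (sum_nonneg_of_mem_copCone hL.2.2 s)
  obtain ⟨n, hn⟩ := ENat.ne_top_iff_exists.1 htop
  have hcard : ∀ s : Finset V, G.IsIndepSet (s : Set V) → s.card ≤ n := by
    intro s hs
    have : (s.card : ℕ∞) ≤ stabilityNumber G :=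
      le_iSup (fun t : {s : Finset V // G.IsIndepSet (s : Set V)} => (t.1.card : ℕ∞)) ⟨s, hs⟩
    rw [← hn] at this
    exact_mod_cast this
  have hcoe : (((stabilityNumber G : ℕ∞) : ℝ≥0∞) : EReal) = ((n : ℝ) : EReal) := by
    rw [← hn, ENat.toENNReal_coe, ← ENNReal.ofReal_natCast, EReal.coe_ennreal_ofReal,
      max_eq_left (Nat.cast_nonneg n)]
  rw [hcoe]
  have hγ := fun (δ : ℝ) (hδ : 0 < δ) => exists_forall_gammaVal_le hG hfeas hcard hδ
  refine ⟨⟨antitone_nat_of_succ_le fun r => optValue_anti G (coneC_subset_succ V r),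
    tendsto_of_forall_le_add
      (fun r => (coe_le_nuVal hn.symm r).trans (nuVal_le_gammaVal G r)) hγ⟩,
    antitone_nat_of_succ_le fun r => optValue_anti G (coneQ_subset_succ V r),
    tendsto_of_forall_le_add (coe_le_nuVal hn.symm) fun δ hδ => ?_⟩
  obtain ⟨r₀, h⟩ := hγ δ hδ
  exact ⟨r₀, fun r hr => (nuVal_le_gammaVal G r).trans (h r hr)⟩
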